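/- Let $K$ be a field of characteristic $0$, let $E=K\langle e_1,\dots,e_n\rangle$ be the exterior algebra on $n$ generators, and for $F=\{i_1<\dots<i_t\}\subseteq\{1,\dots,n\}$ let $e_F=e_{i_1}\wedge\dots\wedge e_{i_t}$ be the corresponding monomial. Let $J\subset E$ be a nonzero monomial ideal (an ideal generated by monomials) which is stable, i.e. for every monomial $u=e_F\in J$ with $F\neq\emptyset$, $m=\max F$, and every $j<m$ one has $e_j\wedge e_{F\setminus\{m\}}\in J$. Assume that $J$ is generated in a single degree $p\ge 2$, i.e. $J$ is generated by its homogeneous elements of degree $p$. Let $A=E/J$ with its induced grading $A=\bigoplus_i A_i$. For $u\in A_1$ let $H^{i}(A,u)$ be the $i$-th cohomology of the complex $0\to A_0\xrightarrow{\,u\,}A_1\xrightarrow{\,u\,}A_2\xrightarrow{\,u\,}\cdots$ whose maps are multiplication by $u$. Let $$R^{i}(A)=\{u\in A_1 : H^{i}(A,u)\neq 0\}$$ be the $i$-th resonance variety of $A$, and let $$V_E(A)=\{u\in A_1 : \{a\in A: ua=0\}\neq uA\}$$ be the rank variety of $A$. Then $$R^{p-1}(A)=V_E(A).$$ In particular,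 $R^{p-1}(A)$ is an irreducible affine variety, that is, a closed and irreducible subset of the affine space $A_1\cong K^{\dim_K A_1}$ with respect to the Zariski topology. -/

import Mathlib

open scoped ExteriorAlgebra

noncomputable section

namespace Resonance

/-! ### The Zariski topology of a finite-dimensional vector space -/

section Zariski

variable (K : Type*) [Field K] (V : Type*) [AddCommGroup V] [Module K V]

/-- The polynomial functions on a finite-dimensional vector space `V`: the algebra of functions
`V → K` generated by the linear forms. In any linear coordinates `V ≅ K ^ m` these are the
functions given by polynomials in `m` variables. -/
def polynomialFunctions : Subalgebra K (V → K) :=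
  Algebra.adjoin K (Set.range fun φ : Module.Dual K V => (φ : V → K))

/-- An algebraic subset of `V`: the set of common zeros of a family of polynomial functions. -/
def IsAlgebraicSet (Z : Set V) : Prop :=
  ∃ S : Set (V → K), S ⊆ polynomialFunctions K V ∧ Z = {x | ∀ f ∈ S, f x = 0}

/-- The Zariski topology of `V`: the closed sets are the algebraic subsets. -/
@[reducible]
def zariskiTopology : TopologicalSpace V :=
  TopologicalSpace.ofClosed {Z | IsAlgebraicSet K V Z}
    ⟨{1}, by simp [(polynomialFunctions K V).one_mem], by ext x; simp⟩
    (by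
      intro A hA
      have hA' : ∀ Z ∈ A, IsAlgebraicSet K V Z := fun Z h => hA h
      choose! S hS hZ using hA'
      refine ⟨⋃ Z ∈ A, S Z, Set.iUnion₂_subset hS, ?_⟩
      ext x
      simp only [Set.mem_sInter, Set.mem_iUnion, Set.mem_ofPred_eq]
      constructor
      · rintro h f ⟨Z, hZA, hf⟩
        have hx := h Z hZA
        rw [hZ Z hZA] at hx
        exact hx f hf
      · intro h Z hZA
        rw [hZ Z hZA]
        exact fun f hf => h f ⟨Z, hZA, hf⟩)
    (by
      rintro _ ⟨S, hS, rfl⟩ _ ⟨T, hT, rfl⟩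
      refine ⟨Set.image2 (fun f g => f * g) S T, ?_, ?_⟩
      · rintro _ ⟨f, hf, g, hg, rfl⟩
        exact mul_mem (hS hf) (hT hg)
      · ext x
        simp only [Set.mem_union, Set.mem_ofPred_eq, Set.forall_mem_image2, Pi.mul_apply,
          mul_eq_zero]
        constructor
        · rintro (h | h) f hf g hg
          · exact Or.inl (h f hf)
          · exact Or.inr (h g hg)
        · intro h
          by_contra! hc
          obtain ⟨⟨f, hf, hfx⟩, ⟨g, hg, hgx⟩⟩ := hc
          exact (h f hf g hg).elim hfx hgx)

variable {V}

/-- `Z` is an irreducible affine variety in the affine space `V`: it is closed and irreducible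
(in particular non-empty) in the Zariski topology. -/
def IsIrreducibleVariety (Z : Set V) : Prop :=
  letI : TopologicalSpace V := zariskiTopology K V
  IsClosed Z ∧ IsIrreducible Z

end Zariski

variable (K : Type*) [Field K] (n : ℕ)

/-! ### The exterior algebra and its monomial ideals

The basis `e₁, …, eₙ` is indexed by `Fin n`. -/

/-- The exterior algebra `E = K⟨e₁, …, eₙ⟩`. -/
abbrev Ext : Type _ := ExteriorAlgebra K (Fin n → K)

/-- The homogeneous component of degree `i` of `E`. -/
abbrev extDegree (i : ℕ) : Submodule K (Ext K n) := ⋀[K]^i (Fin n → K)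

variable {n}

/-- The variable `e_j` of `E`. -/
def var (j : Fin n) : Ext K n := ExteriorAlgebra.ι K (Pi.single j 1)

/-- The monomial `e_F`, the exterior product of the `e_i`, `i ∈ F`, in increasing order of `i`;
as `F` varies these are the elements of the standard basis of `E`. -/
def monomial (F : Finset (Fin n)) : Ext K n :=
  ExteriorAlgebra.ιMulti K F.card fun i => (Pi.single (F.orderEmbOfFin rfl i) 1 : Fin n → K)

theorem monomial_eq_basis (F : Finset (Fin n)) :
    monomial K F = (Pi.basisFun K (Fin n)).ExteriorAlgebra F := by
  rw [ExteriorAlgebra.basis_apply_ofCard _ (rfl : F.card = F.card), monomial]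
  refine congrArg _ (funext fun i => ?_)
  exact (Pi.basisFun_apply K (Fin n) _).symm

variable {K}

/-- A monomial ideal: an ideal generated by monomials. (A left ideal generated by monomials is
two-sided.) -/
def IsMonomialIdeal (J : Ideal (Ext K n)) : Prop :=
  ∃ S : Set (Finset (Fin n)), J = Ideal.span (monomial K '' S)

/-- The exchange condition of stable ideals: `e_j (u / e_{max u}) ∈ J` for every monomial
`u = e_F ∈ J` and every `j < max u = max F`; up to sign, `u / e_{max u}` is `e_{F \ {max F}}`. -/
def IsStable (J : Ideal (Ext K n)) : Prop :=
  ∀ (F : Finset (Fin n)) (hF : F.Nonempty), monomial K F ∈ J →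
    ∀ j < F.max' hF, var K j * monomial K (F.erase (F.max' hF)) ∈ J

/-- The ideal `J` is generated in the single degree `p`. -/
def IsGeneratedInDegree (J : Ideal (Ext K n)) (p : ℕ) : Prop :=
  J = Ideal.span ((J : Set (Ext K n)) ∩ (extDegree K n p : Set (Ext K n)))

/-! ### The algebra `A = E / J`, its resonance varieties and its rank variety -/

variable (J : Ideal (Ext K n)) [J.IsTwoSided]

/-- The homogeneous component `A_i` of `A = E / J`. -/
def quotDegree (i : ℕ) : Submodule K (Ext K n ⧸ J) :=
  (extDegree K n i).map (Ideal.Quotient.mkₐ K J).toLinearMap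

/-- The cocycles of degree `p` of the complex `(A, u)`, whose differential `A_i → A_{i+1}` is
multiplication by `u`. (Multiplications by `u` on the left and on the right agree up to the sign
`(-1) ^ i` on `A_i`, so that they have the same kernels and images.) -/
def cocycles (u : quotDegree J 1) (p : ℕ) : Submodule K (Ext K n ⧸ J) :=
  quotDegree J p ⊓ LinearMap.ker (LinearMap.mulLeft K (u : Ext K n ⧸ J))

/-- The coboundaries of degree `p` of the complex `(A, u)`. -/
def coboundaries (u : quotDegree J 1) : ℕ → Submodule K (Ext K n ⧸ J)
  | 0 => ⊥
  | p + 1 => (quotDegree J p).map (LinearMap.mulLeft K (u : Ext K n ⧸ J))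

theorem mul_self_eq_zero_of_mem (u : quotDegree J 1) :
    (u : Ext K n ⧸ J) * (u : Ext K n ⧸ J) = 0 := by
  obtain ⟨_, x, hx, rfl⟩ := u
  obtain ⟨m, rfl⟩ : ∃ m, ExteriorAlgebra.ι K m = x := by simpa using hx
  change Ideal.Quotient.mkₐ K J _ * Ideal.Quotient.mkₐ K J _ = 0
  rw [← map_mul, ExteriorAlgebra.ι_sq_zero, map_zero]

/-- `(A, u)` is a complex. -/
theorem coboundaries_le_cocycles (u : quotDegree J 1) (p : ℕ) :
    coboundaries J u p ≤ cocycles J u p := by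
  cases p with
  | zero => exact bot_le
  | succ p =>
    rintro _ ⟨a, ha, rfl⟩
    refine ⟨?_, ?_⟩
    · obtain ⟨x, hx, rfl⟩ := ha
      obtain ⟨_, y, hy, rfl⟩ := u
      refine ⟨y * x, ?_, map_mul (Ideal.Quotient.mkₐ K J) y x⟩
      have h := SetLike.GradedMul.mul_mem (A := fun i : ℕ => ⋀[K]^i (Fin n → K)) hy hx
      rwa [add_comm] at h
    · change (u : Ext K n ⧸ J) * (u * a) = 0
      rw [← mul_assoc, mul_self_eq_zero_of_mem, zero_mul]

/-- The cohomology `H^p(A, u)`: cocycles modulo coboundaries. -/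
abbrev Cohomology (u : quotDegree J 1) (p : ℕ) : Type _ :=
  cocycles J u p ⧸ (coboundaries J u p).submoduleOf (cocycles J u p)

/-- The `p`-th resonance variety `R^p(A) = {u ∈ A_1 : H^p(A, u) ≠ 0}` of `A = E / J`. -/
def resonanceVariety (p : ℕ) : Set (quotDegree J 1) :=
  {u | Nontrivial (Cohomology J u p)}

/-- The rank variety `V_E(A)` of `A = E / J`: the set of all `u ∈ A_1` such that the set of
elements of `A` annihilated by `u` is not the same as `u A`. -/
def rankVariety : Set (quotDegree J 1) :=
  {u | {a : Ext K n ⧸ J | (u : Ext K n ⧸ J) * a = 0} ≠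
    Set.range fun a : Ext K n ⧸ J => (u : Ext K n ⧸ J) * a}

end Resonance

end

namespace Resonance

open CliffordAlgebra

/-! ### Linear subspaces are irreducible varieties -/

section Zariski

variable {K V : Type*} [Field K] [AddCommGroup V] [Module K V]

/-! Let `m` be the largest index of a variable occurring in a degree-`p` monomial of `J`; these
monomials generate `J`. Both varieties equal the linear space of classes of forms `v` supported on
indices `≤ m`, and a linear subspace over an infinite field is irreducible
(`isIrreducibleVariety_submodule`).

Outside this space some `v k ≠ 0` with `k > m`. Contraction by the `k`-th coordinate `d` kills every
generator, hence preserves `J`, and `d (v x) = d(v) x - v d(x)` makes `d / d(v)` a contracting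
homotopy on `A` (`mk_eq_mul_contractLeft`). So `ker u = u A`, also degree by degree.

Inside it, let `e_F ∈ J` have degree `p` and maximum `m`. For `v ≠ 0`, stability yields `j ∈ F` with
`0 ≠ v e_{F \ j} ∈ J` (`exists_ι_mul_monomial_mem`), so `e_{F \ j}` is a cocycle of degree `p - 1`.
As `J` vanishes in that degree, a coboundary there would be killed by `v` already in `E`
(`ι_mul_eq_zero_of_mk_eq_mul`). One class thus witnesses membership in both varieties. -/

theorem exists_polynomial_eq_on_line {f : V → K} (hf : f ∈ polynomialFunctions K V) (a b : V) :
    ∃ P : Polynomial K, ∀ t : K, f (a + t • b) = P.eval t := by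
  induction hf using Algebra.adjoin_induction with
  | mem x hx =>
    obtain ⟨φ, rfl⟩ := hx
    exact ⟨.C (φ a) + .C (φ b) * .X, fun t => by simp [mul_comm t]⟩
  | algebraMap r => exact ⟨.C r, fun t => by simp⟩
  | add f g _ _ hf hg =>
    obtain ⟨P, hP⟩ := hf
    obtain ⟨Q, hQ⟩ := hg
    exact ⟨P + Q, fun t => by simp [hP, hQ]⟩
  | mul f g _ _ hf hg =>
    obtain ⟨P, hP⟩ := hf
    obtain ⟨Q, hQ⟩ := hg
    exact ⟨P * Q, fun t => by simp [hP, hQ]⟩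

theorem isAlgebraicSet_submodule (W : Submodule K V) : IsAlgebraicSet K V (W : Set V) := by
  refine ⟨(fun φ : Module.Dual K V => (φ : V → K)) '' {φ | φ ∈ W.dualAnnihilator}, ?_, ?_⟩
  · rintro _ ⟨φ, -, rfl⟩
    exact Algebra.subset_adjoin ⟨φ, rfl⟩
  · ext x
    simp only [SetLike.mem_coe, Set.mem_ofPred_eq, Set.forall_mem_image]
    exact (Subspace.forall_mem_dualAnnihilator_apply_eq_zero_iff W x).symm

theorem isClosed_zariskiTopology_iff {Z : Set V} :
    @IsClosed V (zariskiTopology K V) Z ↔ IsAlgebraicSet K V Z := by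
  let : TopologicalSpace V := zariskiTopology K V
  rw [← isOpen_compl_iff]
  change Zᶜᶜ ∈ {Z | IsAlgebraicSet K V Z} ↔ _
  rw [compl_compl, Set.mem_ofPred_eq]

/-- If neither closed set contained `W`, some `f` and `g` from their equations would be nonzero at
points `a` and `b` of `W`. On the line through `a` and `b` their product is a nonzero polynomial in
`t` vanishing at every `t`, impossible over an infinite field. -/
theorem isIrreducibleVariety_submodule [Infinite K] (W : Submodule K V) :
    IsIrreducibleVariety K (W : Set V) := by
  let : TopologicalSpace V := zariskiTopology K V
  refine ⟨isClosed_zariskiTopology_iff.2 (isAlgebraicSet_submodule W), ⟨0, W.zero_mem⟩,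
    isPreirreducible_iff_isClosed_union_isClosed.2 fun Z₁ Z₂ h₁ h₂ h => ?_⟩
  obtain ⟨S, hS, rfl⟩ := isClosed_zariskiTopology_iff.1 h₁
  obtain ⟨T, hT, rfl⟩ := isClosed_zariskiTopology_iff.1 h₂
  by_contra! hc
  simp only [Set.not_subset, Set.mem_ofPred_eq, not_forall] at hc
  obtain ⟨⟨a, ha, f, hf, hfa⟩, ⟨b, hb, g, hg, hgb⟩⟩ := hc
  obtain ⟨P, hP⟩ := exists_polynomial_eq_on_line (hS hf) a (b - a)
  obtain ⟨Q, hQ⟩ := exists_polynomial_eq_on_line (hT hg) a (b - a)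
  have hP0 : P ≠ 0 := by
    rintro rfl
    exact hfa (by simpa using hP 0)
  have hQ0 : Q ≠ 0 := by
    rintro rfl
    exact hgb (by simpa using hQ 1)
  refine mul_ne_zero hP0 hQ0 (Polynomial.funext fun t => ?_)
  rw [Polynomial.eval_mul, Polynomial.eval_zero, ← hP, ← hQ]
  rcases h (W.add_mem ha (W.smul_mem t (W.sub_mem hb ha))) with h | h
  · rw [h f hf, zero_mul]
  · rw [h g hg, mul_zero]

end Zariski

/-! ### Contractions -/

section Contraction

variable {K M : Type*} [Field K] [AddCommGroup M] [Module K M] (d : Module.Dual K M)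

theorem contractLeft_ι_mul_exterior (v : M) (x : ExteriorAlgebra K M) :
    contractLeft d (ExteriorAlgebra.ι K v * x) =
      d v • x - ExteriorAlgebra.ι K v * contractLeft d x :=
  contractLeft_ι_mul (Q := (0 : QuadraticForm K M)) d v x

theorem contractLeft_mem_exteriorPower {i : ℕ} {x : ExteriorAlgebra K M} (hx : x ∈ ⋀[K]^(i + 1) M) :
    contractLeft d x ∈ ⋀[K]^i M := by
  induction i generalizing x with
  | zero =>
    obtain ⟨v, rfl⟩ : ∃ v, ExteriorAlgebra.ι K v = x := by simpa using hx
    have h := contractLeft_ι (Q := (0 : QuadraticForm K M)) (d := d) v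
    rw [show contractLeft d (ExteriorAlgebra.ι K v) = _ from h]
    exact SetLike.algebraMap_mem_graded (fun i : ℕ => ⋀[K]^i M) (d v)
  | succ i ih =>
    rw [ExteriorAlgebra.exteriorPower, pow_succ'] at hx
    induction hx using Submodule.mul_induction_on' with
    | mem_mul_mem y hy x hx =>
      obtain ⟨v, rfl⟩ := hy
      rw [contractLeft_ι_mul_exterior]
      refine Submodule.sub_mem _ (Submodule.smul_mem _ _ hx) ?_
      rw [ExteriorAlgebra.exteriorPower, pow_succ']
      exact Submodule.mul_mem_mul ⟨v, rfl⟩ (ih hx)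
    | add x _ y _ hx hy => rw [map_add]; exact Submodule.add_mem _ hx hy

theorem contractLeft_ιMulti_eq_zero {k : ℕ} {f : Fin k → M} (hf : ∀ i, d (f i) = 0) :
    contractLeft d (ExteriorAlgebra.ιMulti K k f) = 0 := by
  induction k with
  | zero =>
    rw [ExteriorAlgebra.ιMulti_zero_apply]
    exact contractLeft_one (Q := (0 : QuadraticForm K M)) (d := d)
  | succ k ih =>
    rw [ExteriorAlgebra.ιMulti_succ_apply, contractLeft_ι_mul_exterior, hf,
      ih (f := Matrix.vecTail f) fun i => hf i.succ]
    simp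

/-- Contraction is an antiderivation, so once it kills the generators it sends each multiple `a * s`
back into the left ideal; the coefficient `a` is built up one vector at a time. -/
theorem contractLeft_mem_span {S : Set (ExteriorAlgebra K M)}
    (hS : ∀ s ∈ S, contractLeft d s = 0) {x : ExteriorAlgebra K M} (hx : x ∈ Ideal.span S) :
    contractLeft d x ∈ Ideal.span S := by
  induction hx using Submodule.span_induction with
  | mem x hx => rw [hS x hx]; exact zero_mem _
  | zero => rw [map_zero]; exact zero_mem _
  | add x y _ _ hx hy => rw [map_add]; exact add_mem hx hy
  | smul a x hx ih =>
    rw [smul_eq_mul]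
    induction a using CliffordAlgebra.left_induction with
    | algebraMap r =>
      rw [← Algebra.smul_def, map_smul, Algebra.smul_def]
      exact Ideal.mul_mem_left _ _ ih
    | add a b ha hb => rw [add_mul, map_add]; exact add_mem ha hb
    | ι_mul a v ha =>
      rw [mul_assoc]
      have h := contractLeft_ι_mul_exterior d v (a * x)
      refine (congrArg (· ∈ Ideal.span S) h).mpr ?_
      refine sub_mem ?_ (Ideal.mul_mem_left _ _ ha)
      rw [Algebra.smul_def]
      exact Ideal.mul_mem_left _ _ (Ideal.mul_mem_left _ _ hx)

end Contraction

/-! ### Monomials -/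

section Monomial

variable {K : Type*} [Field K] {n : ℕ}

theorem exists_ιMulti_single_eq_smul_monomial {k : ℕ} {F : Finset (Fin n)} (hk : F.card = k)
    {f : Fin k → Fin n} (hf : Function.Injective f) (hF : ∀ i, f i ∈ F) :
    ∃ ε : ℤˣ, ExteriorAlgebra.ιMulti K k (fun i => (Pi.single (f i) 1 : Fin n → K)) =
      ε • monomial K F := by
  subst hk
  have hinj : Function.Injective fun i => (F.orderIsoOfFin rfl).symm ⟨f i, hF i⟩ := fun i j h =>
    hf (congrArg Subtype.val ((F.orderIsoOfFin rfl).symm.injective h))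
  refine ⟨Equiv.Perm.sign (Equiv.ofBijective _ (Finite.injective_iff_bijective.1 hinj)), ?_⟩
  rw [monomial, ← AlternatingMap.map_perm]
  congr 1
  funext i
  simp [← Finset.coe_orderIsoOfFin_apply]

theorem exists_var_mul_monomial_erase {j : Fin n} {F : Finset (Fin n)} (hj : j ∈ F) :
    ∃ ε : ℤˣ, var K j * monomial K (F.erase j) = ε • monomial K F := by
  obtain ⟨ε, h⟩ := exists_ιMulti_single_eq_smul_monomial (K := K) (F := F)
    (k := (F.erase j).card + 1) (Finset.card_erase_add_one hj).symm
    (f := Fin.cons j ((F.erase j).orderEmbOfFin rfl))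
    (Fin.cons_injective_iff.2 ⟨by
      simp, ((F.erase j).orderEmbOfFin rfl).injective⟩)
    (fun i => by
      refine Fin.cases ?_ (fun i => ?_) i
      · simpa using hj
      · exact Finset.mem_of_mem_erase (Finset.orderEmbOfFin_mem (F.erase j) rfl i))
  refine ⟨ε, h ▸ ?_⟩
  rw [ExteriorAlgebra.ιMulti_succ_apply]
  rfl

theorem var_mul_monomial_eq_zero {j : Fin n} {F : Finset (Fin n)} (hj : j ∈ F) :
    var K j * monomial K F = 0 := by
  obtain ⟨ε, h⟩ := exists_var_mul_monomial_erase (K := K) hj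
  have h' : monomial K F = ε⁻¹ • (var K j * monomial K (F.erase j)) := by
    rw [h, smul_smul, inv_mul_cancel, one_smul]
  rw [h', mul_smul_comm, ← mul_assoc, var, ExteriorAlgebra.ι_sq_zero, zero_mul, smul_zero]

theorem monomial_mem_extDegree (F : Finset (Fin n)) : monomial K F ∈ extDegree K n F.card :=
  ExteriorAlgebra.ιMulti_range K F.card ⟨_, rfl⟩

theorem monomial_ne_zero (F : Finset (Fin n)) : monomial K F ≠ 0 := by
  rw [monomial_eq_basis]
  exact Module.Basis.ne_zero _ F

theorem contractLeft_monomial_eq_zero {k : Fin n} {F : Finset (Fin n)} (hk : k ∉ F) :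
    contractLeft (LinearMap.proj k : Module.Dual K (Fin n → K)) (monomial K F) = 0 := by
  refine contractLeft_ιMulti_eq_zero _ fun i => ?_
  refine Pi.single_eq_of_ne ?_ _
  rintro rfl
  exact hk (F.orderEmbOfFin_mem rfl i)

/-- Contracting by the `k`-th coordinate recovers `v k • e_F`. -/
theorem ι_mul_monomial_ne_zero {v : Fin n → K} {k : Fin n} (hv : v k ≠ 0)
    {F : Finset (Fin n)} (hk : k ∉ F) : ExteriorAlgebra.ι K v * monomial K F ≠ 0 := by
  intro h
  have h' := contractLeft_ι_mul_exterior (LinearMap.proj k) v (monomial K F)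
  rw [h, map_zero, contractLeft_monomial_eq_zero hk, mul_zero, sub_zero] at h'
  exact smul_ne_zero hv (monomial_ne_zero F) h'.symm

theorem ι_mul_mem {J : Ideal (Ext K n)} {v : Fin n → K} {x : Ext K n}
    (h : ∀ i, v i ≠ 0 → var K i * x ∈ J) : ExteriorAlgebra.ι K v * x ∈ J := by
  have hv : v = ∑ i, v i • (Pi.single i 1 : Fin n → K) := by
    ext i
    simp [Finset.sum_apply, Pi.single_apply]
  rw [hv, map_sum, Finset.sum_mul]
  refine sum_mem fun i _ => ?_
  rw [map_smul, smul_mul_assoc]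
  by_cases hi : v i = 0
  · rw [hi, zero_smul]; exact zero_mem _
  · rw [Algebra.smul_def]
    exact Ideal.mul_mem_left _ _ (h i hi)

theorem units_smul_mem {J : Ideal (Ext K n)} (ε : ℤˣ) {x : Ext K n} (hx : x ∈ J) : ε • x ∈ J := by
  rcases Int.units_eq_one_or ε with rfl | rfl
  · simpa using hx
  · simpa using hx

theorem decompose_eq_zero_of_mem {J : Ideal (Ext K n)} {p : ℕ} (hJ : IsGeneratedInDegree J p)
    {i : ℕ} (hi : i < p) {x : Ext K n} (hx : x ∈ J) :
    (DirectSum.decompose (extDegree K n) x i : Ext K n) = 0 := by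
  rw [hJ] at hx
  -- All left multiples are treated at once, so that the scalar step of the span induction is
  -- absorbed into `a`.
  suffices h : ∀ a : Ext K n, (DirectSum.decompose (extDegree K n) (a * x) i : Ext K n) = 0 by
    simpa using h 1
  intro a
  induction hx using Submodule.span_induction generalizing a with
  | mem x hx => exact DirectSum.coe_decompose_mul_of_right_mem_of_not_le _ hx.2 (by omega)
  | zero => simp
  | add x y _ _ hx hy =>
    rw [mul_add, DirectSum.decompose_add, DirectSum.add_apply, Submodule.coe_add, hx, hy, add_zero]
  | smul b x _ ih => rw [smul_eq_mul, ← mul_assoc]; exact ih _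

theorem eq_zero_of_mem_of_mem_extDegree {J : Ideal (Ext K n)} {p : ℕ}
    (hJ : IsGeneratedInDegree J p) {i : ℕ} (hi : i < p) {x : Ext K n} (hx : x ∈ J)
    (hxi : x ∈ extDegree K n i) : x = 0 := by
  rw [← DirectSum.decompose_of_mem_same (extDegree K n) hxi]
  exact decompose_eq_zero_of_mem hJ hi hx

theorem eq_span_monomial_of_isGeneratedInDegree {J : Ideal (Ext K n)} {p : ℕ}
    (hmon : IsMonomialIdeal J) (hJ : IsGeneratedInDegree J p) :
    J = Ideal.span (monomial K '' {F | F.card = p ∧ monomial K F ∈ J}) := by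
  refine le_antisymm ?_ (Ideal.span_le.2 ?_)
  · obtain ⟨S, hS⟩ := hmon
    have hSJ : ∀ F ∈ S, monomial K F ∈ J := fun F hF => by
      rw [hS]
      exact Ideal.subset_span ⟨F, hF, rfl⟩
    -- Projecting a combination of monomial generators to degree `p` kills those of degree above
    -- `p`, and none has degree below `p` because `J` is zero there.
    have hproj : ∀ x ∈ J, (DirectSum.decompose (extDegree K n) x p : Ext K n) ∈
        Ideal.span (monomial K '' {F | F.card = p ∧ monomial K F ∈ J}) := by
      intro x hx
      rw [hS] at hx
      obtain ⟨c, hc⟩ := (Finsupp.mem_span_image_iff_linearCombination _).1 hx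
      rw [← hc.2, Finsupp.linearCombination_apply, Finsupp.sum, DirectSum.decompose_sum,
        DirectSum.sum_apply, AddSubmonoidClass.coe_finsetSum]
      refine sum_mem fun F hF => ?_
      have hFJ := hSJ F (hc.1 hF)
      rw [smul_eq_mul]
      by_cases h : F.card ≤ p
      · have hFp : F.card = p := by
          by_contra hne
          exact monomial_ne_zero F (eq_zero_of_mem_of_mem_extDegree hJ (lt_of_le_of_ne h hne) hFJ
            (monomial_mem_extDegree F))
        rw [DirectSum.coe_decompose_mul_of_right_mem_of_le _ (monomial_mem_extDegree F) h]
        exact Ideal.mul_mem_left _ _ (Ideal.subset_span ⟨F, ⟨hFp, hFJ⟩, rfl⟩)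
      · rw [DirectSum.coe_decompose_mul_of_right_mem_of_not_le _ (monomial_mem_extDegree F) h]
        exact zero_mem _
    conv_lhs => rw [hJ]
    refine Ideal.span_le.2 fun x hx => ?_
    have h := hproj x hx.1
    rwa [DirectSum.decompose_of_mem_same _ hx.2] at h
  · rintro _ ⟨F, hF, rfl⟩
    exact hF.2

theorem var_mul_monomial_erase_max_mem {J : Ideal (Ext K n)} (hstable : IsStable J)
    {F : Finset (Fin n)} (hF : F.Nonempty) (hFJ : monomial K F ∈ J) {j : Fin n}
    (hj : j ≤ F.max' hF) : var K j * monomial K (F.erase (F.max' hF)) ∈ J := by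
  rcases hj.lt_or_eq with h | rfl
  · exact hstable F hF hFJ j h
  · obtain ⟨ε, h⟩ := exists_var_mul_monomial_erase (K := K) (F.max'_mem hF)
    rw [h]
    exact units_smul_mem ε hFJ

/-- If the support of `v ≠ 0` is bounded by the maximum of a monomial of a stable ideal `J`, then
`J` contains a nonzero multiple of `v`. -/
theorem exists_ι_mul_monomial_mem {J : Ideal (Ext K n)} (hstable : IsStable J)
    {F : Finset (Fin n)} (hF : F.Nonempty) (hFJ : monomial K F ∈ J) {v : Fin n → K} (hv0 : v ≠ 0)
    (hv : ∀ k, F.max' hF < k → v k = 0) :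
    ∃ j ∈ F, ExteriorAlgebra.ι K v * monomial K (F.erase j) ∈ J ∧
      ExteriorAlgebra.ι K v * monomial K (F.erase j) ≠ 0 := by
  by_cases h : ∃ j, v j ≠ 0 ∧ j ∉ F
  -- Support not inside `F`: remove the maximum. Stability puts every `e_i e_{F \ max}` with `i ≤
  -- max F` in `J`, and an index of the support outside `F` makes the product nonzero.
  · obtain ⟨j, hvj, hjF⟩ := h
    refine ⟨F.max' hF, F.max'_mem hF, ι_mul_mem fun i hi => ?_,
      ι_mul_monomial_ne_zero hvj fun h => hjF (Finset.mem_of_mem_erase h)⟩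
    exact var_mul_monomial_erase_max_mem hstable hF hFJ (not_lt.1 fun h => hi (hv i h))
  -- Support inside `F`: remove any `j` of the support; all terms but the `j`-th vanish, leaving `±
  -- v j • e_F`.
  · push Not at h
    obtain ⟨j, hj⟩ := Function.ne_iff.1 hv0
    refine ⟨j, h j hj, ι_mul_mem fun i hi => ?_,
      ι_mul_monomial_ne_zero hj (Finset.notMem_erase j F)⟩
    by_cases hij : i = j
    · subst hij
      obtain ⟨ε, hε⟩ := exists_var_mul_monomial_erase (K := K) (h i hi)
      rw [hε]
      exact units_smul_mem ε hFJ
    · rw [var_mul_monomial_eq_zero (Finset.mem_erase.2 ⟨hij, h i hi⟩)]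
      exact zero_mem _

end Monomial

/-! ### Resonance and rank varieties -/

section Variety

variable {K : Type*} [Field K] {n : ℕ} {J : Ideal (Ext K n)} [J.IsTwoSided]

theorem mem_resonanceVariety_iff {p : ℕ} {u : quotDegree J 1} :
    u ∈ resonanceVariety J p ↔ ¬ cocycles J u p ≤ coboundaries J u p := by
  rw [resonanceVariety, Set.mem_ofPred_eq, Submodule.Quotient.nontrivial_iff, ne_eq,
    Submodule.submoduleOf, Submodule.comap_subtype_eq_top]

theorem exists_ι_eq (u : quotDegree J 1) :
    ∃ v : Fin n → K, Ideal.Quotient.mk J (ExteriorAlgebra.ι K v) = u := by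
  obtain ⟨_, x, hx, rfl⟩ := u
  obtain ⟨v, rfl⟩ : ∃ v, ExteriorAlgebra.ι K v = x := by simpa using hx
  exact ⟨v, rfl⟩

theorem mk_eq_mul_contractLeft {d : Module.Dual K (Fin n → K)}
    (hd : ∀ x ∈ J, contractLeft d x ∈ J) {v : Fin n → K} (hv : d v ≠ 0) {x : Ext K n}
    (hx : Ideal.Quotient.mk J (ExteriorAlgebra.ι K v) * Ideal.Quotient.mk J x = 0) :
    Ideal.Quotient.mk J x = Ideal.Quotient.mk J (ExteriorAlgebra.ι K v) *
      Ideal.Quotient.mk J ((d v)⁻¹ • contractLeft d x) := by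
  rw [← map_mul, Ideal.Quotient.eq_zero_iff_mem] at hx
  have h := hd _ hx
  rw [contractLeft_ι_mul_exterior] at h
  rw [← map_mul, Ideal.Quotient.eq]
  have h' := J.mul_mem_left (algebraMap K _ (d v)⁻¹) h
  rwa [← Algebra.smul_def, smul_sub, smul_smul, inv_mul_cancel₀ hv, one_smul,
    ← mul_smul_comm] at h'

theorem notMem_rankVariety {d : Module.Dual K (Fin n → K)} (hd : ∀ x ∈ J, contractLeft d x ∈ J)
    {v : Fin n → K} (hv : d v ≠ 0) {u : quotDegree J 1}
    (hu : Ideal.Quotient.mk J (ExteriorAlgebra.ι K v) = u) : u ∉ rankVariety J := by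
  rw [rankVariety, Set.mem_ofPred_eq, not_not]
  ext a
  constructor
  · intro ha
    obtain ⟨x, rfl⟩ := Ideal.Quotient.mk_surjective a
    rw [Set.mem_ofPred_eq, ← hu] at ha
    exact ⟨_, by rw [mk_eq_mul_contractLeft hd hv ha, hu]⟩
  · rintro ⟨b, rfl⟩
    rw [Set.mem_ofPred_eq, ← mul_assoc, mul_self_eq_zero_of_mem, zero_mul]

/-- The homotopy lowers degree by one, so the primitive it gives is homogeneous of degree `q`. -/
theorem notMem_resonanceVariety {d : Module.Dual K (Fin n → K)}
    (hd : ∀ x ∈ J, contractLeft d x ∈ J) {v : Fin n → K} (hv : d v ≠ 0) {u : quotDegree J 1}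
    (hu : Ideal.Quotient.mk J (ExteriorAlgebra.ι K v) = u) (q : ℕ) :
    u ∉ resonanceVariety J (q + 1) := by
  rw [mem_resonanceVariety_iff, not_not]
  rintro _ ⟨⟨x, hx, rfl⟩, ha⟩
  have ha' : (u : Ext K n ⧸ J) * Ideal.Quotient.mk J x = 0 := ha
  rw [← hu] at ha'
  refine ⟨_, ⟨(d v)⁻¹ • contractLeft d x,
    Submodule.smul_mem _ _ (contractLeft_mem_exteriorPower d hx), rfl⟩, ?_⟩
  have h := mk_eq_mul_contractLeft hd hv ha'
  rw [hu] at h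
  exact h.symm

/-- Below the generating degree, a homogeneous element that becomes a multiple of `v` modulo `J` is
killed by `v`. -/
theorem ι_mul_eq_zero_of_mk_eq_mul {q : ℕ} (hgen : IsGeneratedInDegree J (q + 2)) {v : Fin n → K}
    {x y : Ext K n} (hx : x ∈ extDegree K n (q + 1))
    (h : Ideal.Quotient.mk J (ExteriorAlgebra.ι K v) * Ideal.Quotient.mk J y =
      Ideal.Quotient.mk J x) : ExteriorAlgebra.ι K v * x = 0 := by
  rw [← map_mul, Ideal.Quotient.eq] at h
  have h' := decompose_eq_zero_of_mem hgen (i := q + 1) (by omega) h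
  have hv : ExteriorAlgebra.ι K v ∈ extDegree K n 1 := by simp
  rw [DirectSum.decompose_sub, DirectSum.sub_apply, AddSubgroupClass.coe_sub,
    DirectSum.decompose_of_mem_same _ hx,
    DirectSum.coe_decompose_mul_of_left_mem_of_le _ hv (by omega), sub_eq_zero] at h'
  rw [← h', ← mul_assoc, ExteriorAlgebra.ι_sq_zero, zero_mul]

/-- In `hx0` the element `y` need not be homogeneous: the rank variety requires that no element of
`A` at all be a primitive. -/
theorem mem_resonanceVariety_and_rankVariety {q : ℕ}
    {v : Fin n → K} {u : quotDegree J 1}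
    (hu : Ideal.Quotient.mk J (ExteriorAlgebra.ι K v) = u) {x : Ext K n}
    (hx : x ∈ extDegree K n (q + 1)) (hxJ : ExteriorAlgebra.ι K v * x ∈ J)
    (hx0 : ∀ y, Ideal.Quotient.mk J (ExteriorAlgebra.ι K v) * Ideal.Quotient.mk J y ≠
      Ideal.Quotient.mk J x) :
    u ∈ resonanceVariety J (q + 1) ∧ u ∈ rankVariety J := by
  have hux : (u : Ext K n ⧸ J) * Ideal.Quotient.mk J x = 0 := by
    rw [← hu, ← map_mul, Ideal.Quotient.eq_zero_iff_mem]
    exact hxJ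
  constructor
  · rw [mem_resonanceVariety_iff]
    intro h
    obtain ⟨_, ⟨y, -, rfl⟩, hy⟩ := h (x := Ideal.Quotient.mk J x) ⟨⟨x, hx, rfl⟩, hux⟩
    exact hx0 y (by rw [hu]; exact hy)
  · intro h
    obtain ⟨b, hb⟩ := h.subset hux
    obtain ⟨y, rfl⟩ := Ideal.Quotient.mk_surjective b
    exact hx0 y (by rw [hu]; exact hb)

theorem mem_varieties_of_support_le {q : ℕ} (hgen : IsGeneratedInDegree J (q + 2))
    (hstable : IsStable J) {F : Finset (Fin n)} (hcard : F.card = q + 2) (hF : F.Nonempty)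
    (hFJ : monomial K F ∈ J) {v : Fin n → K} (hv : ∀ k, F.max' hF < k → v k = 0)
    {u : quotDegree J 1} (hu : Ideal.Quotient.mk J (ExteriorAlgebra.ι K v) = u) :
    u ∈ resonanceVariety J (q + 1) ∧ u ∈ rankVariety J := by
  have hdeg : ∀ j ∈ F, monomial K (F.erase j) ∈ extDegree K n (q + 1) := fun j hj => by
    have h := monomial_mem_extDegree (K := K) (F.erase j)
    rwa [Finset.card_erase_of_mem hj, hcard] at h
  by_cases hv0 : v = 0
  -- Multiplication by `0` kills everything and hits only `0`, so any nonzero class of degree `q +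
  -- 1` serves; monomials of that degree survive in `A`.
  · subst hv0
    have hm := hdeg _ (F.max'_mem hF)
    refine mem_resonanceVariety_and_rankVariety hu hm (by simp) fun y hy => ?_
    rw [map_zero, map_zero, zero_mul, eq_comm, Ideal.Quotient.eq_zero_iff_mem] at hy
    exact monomial_ne_zero _ (eq_zero_of_mem_of_mem_extDegree hgen (by omega) hy hm)
  · obtain ⟨j, hj, hmem, hne⟩ := exists_ι_mul_monomial_mem hstable hF hFJ hv0 hv
    exact mem_resonanceVariety_and_rankVariety hu (hdeg j hj) hmem fun y hy =>
      hne (ι_mul_eq_zero_of_mk_eq_mul hgen (hdeg j hj) hy)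

variable (J) in
/-- The classes in `A₁` of the linear combinations of the variables `e_k` with `k ≤ m`. -/
def initialLinearForms (m : Fin n) : Submodule K (quotDegree J 1) :=
  ((Submodule.pi (Set.Ioi m) fun _ => (⊥ : Submodule K K)).map
    ((Ideal.Quotient.mkₐ K J).toLinearMap ∘ₗ ExteriorAlgebra.ι K)).comap (quotDegree J 1).subtype

theorem mem_initialLinearForms {m : Fin n} {u : quotDegree J 1} :
    u ∈ initialLinearForms J m ↔ ∃ v : Fin n → K, (∀ k, m < k → v k = 0) ∧
      Ideal.Quotient.mk J (ExteriorAlgebra.ι K v) = u := by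
  simp [initialLinearForms, Submodule.mem_map]

theorem exists_varieties_eq_initialLinearForms (hJ : J ≠ ⊥) (hmon : IsMonomialIdeal J)
    (hstable : IsStable J) {q : ℕ} (hgen : IsGeneratedInDegree J (q + 2)) :
    ∃ m : Fin n, resonanceVariety J (q + 1) = initialLinearForms J m ∧
      rankVariety J = initialLinearForms J m := by
  have hspan := eq_span_monomial_of_isGeneratedInDegree hmon hgen
  have hne : {F : Finset (Fin n) | F.card = q + 2 ∧ monomial K F ∈ J}.Nonempty := by
    by_contra h
    rw [Set.not_nonempty_iff_eq_empty] at h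
    rw [h, Set.image_empty, Ideal.span_empty] at hspan
    exact hJ hspan
  -- `F` is a generator with the largest maximum: no variable beyond `max F` occurs in any
  -- generator.
  obtain ⟨F, ⟨hcard, hFJ⟩, hmax⟩ := Set.exists_max_image _ Finset.max (Set.toFinite _) hne
  have hF : F.Nonempty := Finset.card_pos.1 (by omega)
  have key : ∀ u : quotDegree J 1,
      (u ∈ initialLinearForms J (F.max' hF) →
        u ∈ resonanceVariety J (q + 1) ∧ u ∈ rankVariety J) ∧
      (u ∉ initialLinearForms J (F.max' hF) →
        u ∉ resonanceVariety J (q + 1) ∧ u ∉ rankVariety J) := by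
    refine fun u => ⟨fun h => ?_, fun h => ?_⟩
    · obtain ⟨v, hv, hu⟩ := mem_initialLinearForms.1 h
      exact mem_varieties_of_support_le hgen hstable hcard hF hFJ hv hu
    · obtain ⟨v, hu⟩ := exists_ι_eq u
      obtain ⟨k, hk, hvk⟩ : ∃ k, F.max' hF < k ∧ v k ≠ 0 := by
        by_contra! hc
        exact h (mem_initialLinearForms.2 ⟨v, hc, hu⟩)
      have hd : ∀ x ∈ J, contractLeft (LinearMap.proj k : Module.Dual K (Fin n → K)) x ∈ J := by
        intro x hx
        rw [hspan] at hx ⊢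
        refine contractLeft_mem_span _ ?_ hx
        rintro _ ⟨G, hG, rfl⟩
        refine contractLeft_monomial_eq_zero fun hkG => hk.not_ge ?_
        have h := (Finset.le_max hkG).trans (hmax G hG)
        rwa [← Finset.coe_max' hF, WithBot.coe_le_coe] at h
      exact ⟨notMem_resonanceVariety hd hvk hu q, notMem_rankVariety hd hvk hu⟩
  refine ⟨F.max' hF, Set.ext fun u => ?_, Set.ext fun u => ?_⟩
  · exact ⟨fun h => by_contra fun h' => ((key u).2 h').1 h, fun h => ((key u).1 h).1⟩
  · exact ⟨fun h => by_contra fun h' => ((key u).2 h').2 h, fun h => ((key u).1 h).2⟩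

end Variety

end Resonance

theorem corollary3p4 {K : Type*} [Field K] [CharZero K] {n : ℕ}
    (J : Ideal (Resonance.Ext K n)) [J.IsTwoSided] (hJ : J ≠ ⊥)
    (hmon : Resonance.IsMonomialIdeal J) (hstable : Resonance.IsStable J)
    (p : ℕ) (hp : 2 ≤ p) (hgen : Resonance.IsGeneratedInDegree J p) :
    Resonance.resonanceVariety J (p - 1) = Resonance.rankVariety J ∧
      Resonance.IsIrreducibleVariety K (Resonance.resonanceVariety J (p - 1)) := by
  obtain ⟨q, rfl⟩ := Nat.exists_eq_add_of_le' hp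
  obtain ⟨m, hres, hrank⟩ :=
    Resonance.exists_varieties_eq_initialLinearForms hJ hmon hstable hgen
  rw [show q + 2 - 1 = q + 1 from rfl, hres, hrank]
  -- Characteristic zero enters only here, to make `K` infinite.
  have : Infinite K := CharZero.infinite K
  exact ⟨rfl, Resonance.isIrreducibleVariety_submodule _⟩
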